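/- Let $\mathcal{A}$ be an abelian category; "subcategory" means a full additive subcategory closed under isomorphisms, and complexes are homologically indexed by $\mathbb{Z}$. For subcategories $\mathcal{X},\mathcal{Y}$ write $\mathcal{X}\perp\mathcal{Y}$ if $\mathrm{Ext}^n_{\mathcal{A}}(X,Y)=0$ for all $X\in\mathcal{X}$, $Y\in\mathcal{Y}$, $n\ge 1$. An $\mathcal{X}$-resolution of $M$ is a quasi-isomorphism $X\to M$ with all $X_n\in\mathcal{X}$ and $X_n=0$ for $n<0$; it is proper if the augmented complex is $\mathrm{Hom}_{\mathcal{A}}(X',-)$-exact for all $X'\in\mathcal{X}$. Write $\operatorname{res}\widehat{\mathcal{X}}$ for the class of objects of finite $\mathcal{X}$-projective dimension, i.e. those having a bounded $\mathcal{X}$-resolution. Dually, a $\mathcal{Y}$-coresolution of $N$ is a quasi-isomorphism $N\to Y$ with all $Y_n\in\mathcal{Y}$ and $Y_n=0$ for $n>0$; it is proper if the augmented complex is $\mathrm{Hom}_{\mathcal{A}}(-,Y')$-exact for all $Y'\in\mathcal{Y}$; and $\operatorname{cores}\widehat{\mathcal{Y}}$ is the class of objects of finite $\mathcal{Y}$-injective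 dimension, i.e. those having a bounded $\mathcal{Y}$-coresolution. A complex $T$ is totally $\mathcal{W}$-acyclic if it is exact, all $T_n\in\mathcal{W}$, and it is $\mathrm{Hom}_{\mathcal{A}}(W,-)$-exact and $\mathrm{Hom}_{\mathcal{A}}(-,W)$-exact for all $W\in\mathcal{W}$. Let $\mathcal{G}(\mathcal{W})$ be the subcategory of objects isomorphic to $\mathrm{Coker}(T_1\to T_0)$ for some totally $\mathcal{W}$-acyclic $T$. A Tate $\mathcal{W}$-resolution of $M$ is a diagram $T\to W\to M$ with $T$ totally $\mathcal{W}$-acyclic, $W\to M$ a proper $\mathcal{W}$-resolution, and $T_n\to W_n$ an isomorphism for $n\gg0$; then $\widehat{\mathrm{Ext}}{}^n_{\mathcal{W}\mathcal{A}}(M,N)=H_{-n}(\mathrm{Hom}_{\mathcal{A}}(T,N))$. A Tate $\mathcal{V}$-coresolution of $N$ is a diagram $N\to V\to S$ with $S$ totally $\mathcal{V}$-acyclic, $N\to V$ a proper $\mathcal{V}$-coresolution, and $V_n\to S_n$ an isomorphism for $n\ll0$; then $\widehat{\mathrm{Ext}}{}^n_{\mathcal{A}\mathcal{V}}(M,N)=H_{-n}(\mathrm{Hom}_{\mathcal{A}}(M,S))$.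 (These groups do not depend on the chosen (co)resolution.) **Theorem.** Let $\mathcal{W},\mathcal{V}$ be subcategories of $\mathcal{A}$ such that - $\mathcal{W}\perp\mathcal{W}$, $\mathcal{V}\perp\mathcal{V}$, $\mathcal{G}(\mathcal{W})\perp\mathcal{V}$ and $\mathcal{W}\perp\mathcal{G}(\mathcal{V})$; - $\mathcal{W}$ is closed under kernels of epimorphisms and direct summands, and $\mathcal{V}$ is closed under cokernels of monomorphisms and direct summands; - $\widehat{\mathrm{Ext}}{}^{n}_{\mathcal{W}\mathcal{A}}(M,V)=0$ for all $M\in\operatorname{res}\widehat{\mathcal{W}}$, $V\in\mathcal{V}$, $n\ge1$, and $\widehat{\mathrm{Ext}}{}^{n}_{\mathcal{A}\mathcal{V}}(W,N)=0$ for all $W\in\mathcal{W}$, $N\in\operatorname{cores}\widehat{\mathcal{V}}$, $n\ge1$. Then $$\operatorname{res}\widehat{\mathcal{G}(\mathcal{W})}\cap\operatorname{cores}\widehat{\mathcal{V}}\subseteq\operatorname{res}\widehat{\mathcal{W}} \qquad\text{and}\qquad \operatorname{cores}\widehat{\mathcal{G}(\mathcal{V})}\cap\operatorname{res}\widehat{\mathcal{W}}\subseteq\operatorname{cores}\widehat{\mathcal{V}}.$$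 That is, objects of finite $\mathcal{G}(\mathcal{W})$-projective dimension and finite $\mathcal{V}$-injective dimension have finite $\mathcal{W}$-projective dimension, and objects of finite $\mathcal{G}(\mathcal{V})$-injective dimension and finite $\mathcal{W}$-projective dimension have finite $\mathcal{V}$-injective dimension. -/

import Mathlib

open CategoryTheory CategoryTheory.Limits Opposite

universe w v u

namespace RelTate

noncomputable section

variable {A : Type u} [Category.{v} A] [Abelian A]

/-- `𝒳 ⊥ 𝒴`: the groups `Extⁿ(X, Y)` of the abelian category vanish for all `X` in `𝒳`,
all `Y` in `𝒴` and all `n ≥ 1`. -/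
def Perp [HasExt.{w} A] (𝒳 𝒴 : ObjectProperty A) : Prop :=
  ∀ ⦃X Y : A⦄, 𝒳 X → 𝒴 Y → ∀ n : ℕ, 1 ≤ n → Subsingleton (Abelian.Ext.{w} X Y n)

/-- For every exact sequence `0 → K → X → X' → 0` with `X` and `X'` in `𝒳`, also `K` is in `𝒳`. -/
def ClosedUnderKernelsOfEpis (𝒳 : ObjectProperty A) : Prop :=
  ∀ S : ShortComplex A, S.ShortExact → 𝒳 S.X₂ → 𝒳 S.X₃ → 𝒳 S.X₁

/-- For every exact sequence `0 → Y → Y' → K → 0` with `Y` and `Y'` in `𝒴`, also `K` is in `𝒴`. -/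
def ClosedUnderCokernelsOfMonos (𝒴 : ObjectProperty A) : Prop :=
  ∀ S : ShortComplex A, S.ShortExact → 𝒴 S.X₁ → 𝒴 S.X₂ → 𝒴 S.X₃

/-- Every direct summand (equivalently, in an abelian category, every retract) of an object of
`𝒳` is in `𝒳`. -/
def ClosedUnderDirectSummands (𝒳 : ObjectProperty A) : Prop :=
  ∀ M N : A, 𝒳 (M ⊞ N) → 𝒳 M

/-- An object regarded as a chain complex concentrated in degree `0`. -/
abbrev inDegreeZero (M : A) : ChainComplex A ℤ :=
  (HomologicalComplex.single A (ComplexShape.down ℤ) 0).obj M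

/-- The complex of abelian groups `Hom(X, K)`, for an object `X` and a chain complex `K`:
its term of index `n` is `Hom(X, K_n)`. -/
abbrev homFrom (X : A) (K : ChainComplex A ℤ) :
    HomologicalComplex AddCommGrpCat.{v} (ComplexShape.down ℤ) :=
  ((preadditiveCoyoneda.obj (op X)).mapHomologicalComplex (ComplexShape.down ℤ)).obj K

/-- The map `Hom(X, K) → Hom(X, L)` induced by a chain map `K → L`. -/
abbrev homFromMap (X : A) {K L : ChainComplex A ℤ} (f : K ⟶ L) : homFrom X K ⟶ homFrom X L :=
  ((preadditiveCoyoneda.obj (op X)).mapHomologicalComplex (ComplexShape.down ℤ)).map f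

/-- The complex of abelian groups `Hom(K, Y)`, for a chain complex `K` and an object `Y`.
It is indexed cohomologically: its term of index `n` is `Hom(K_n, Y)`, with differential
`Hom(K_n, Y) → Hom(K_{n+1}, Y)`. So index `n` here is homological degree `-n`. -/
abbrev homTo (K : ChainComplex A ℤ) (Y : A) :
    HomologicalComplex AddCommGrpCat.{v} (ComplexShape.down ℤ).symm :=
  ((preadditiveYoneda.obj Y).mapHomologicalComplex (ComplexShape.down ℤ).symm).obj
    ((HomologicalComplex.opFunctor A (ComplexShape.down ℤ)).obj (op K))

/-- The map `Hom(L, Y) → Hom(K, Y)` induced by a chain map `K → L`. -/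
abbrev homToMap {K L : ChainComplex A ℤ} (f : K ⟶ L) (Y : A) : homTo L Y ⟶ homTo K Y :=
  ((preadditiveYoneda.obj Y).mapHomologicalComplex (ComplexShape.down ℤ).symm).map
    ((HomologicalComplex.opFunctor A (ComplexShape.down ℤ)).map f.op)

/-- `γ : X → M` is an `𝒳`-resolution of `M`: a quasi-isomorphism from a chain complex `X` of
objects of `𝒳` with `X_n = 0` for `n < 0`. -/
structure IsResolution (𝒳 : ObjectProperty A) {M : A} (X : ChainComplex A ℤ)
    (γ : X ⟶ inDegreeZero M) : Prop where
  mem : ∀ n : ℤ, 𝒳 (X.X n)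
  isZero : ∀ n : ℤ, n < 0 → IsZero (X.X n)
  quasiIso : QuasiIso γ

/-- The resolution `γ : X → M` is proper: the augmented resolution stays exact under `Hom(X', -)`
for all `X'` in `𝒳`, that is, `Hom(X', γ)` is a quasi-isomorphism. -/
structure IsProperResolution (𝒳 : ObjectProperty A) {M : A} (X : ChainComplex A ℤ)
    (γ : X ⟶ inDegreeZero M) : Prop extends IsResolution 𝒳 X γ where
  proper : ∀ X' : A, 𝒳 X' → QuasiIso (homFromMap X' γ)

/-- `δ : N → Y` is a `𝒴`-coresolution of `N`: a quasi-isomorphism to a chain complex `Y` of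
objects of `𝒴` with `Y_n = 0` for `n > 0`. -/
structure IsCoresolution (𝒴 : ObjectProperty A) {N : A} (Y : ChainComplex A ℤ)
    (δ : inDegreeZero N ⟶ Y) : Prop where
  mem : ∀ n : ℤ, 𝒴 (Y.X n)
  isZero : ∀ n : ℤ, 0 < n → IsZero (Y.X n)
  quasiIso : QuasiIso δ

/-- The coresolution `δ : N → Y` is proper: the augmented coresolution stays exact under
`Hom(-, Y')` for all `Y'` in `𝒴`, that is, `Hom(δ, Y')` is a quasi-isomorphism. -/
structure IsProperCoresolution (𝒴 : ObjectProperty A) {N : A} (Y : ChainComplex A ℤ)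
    (δ : inDegreeZero N ⟶ Y) : Prop extends IsCoresolution 𝒴 Y δ where
  proper : ∀ Y' : A, 𝒴 Y' → QuasiIso (homToMap δ Y')

/-- `res 𝒳^`: the objects of finite `𝒳`-projective dimension, that is, the objects with an
`𝒳`-resolution `X` such that, for some `d`, `X_n = 0` for all `n > d`. -/
def finiteProjDim (𝒳 : ObjectProperty A) : ObjectProperty A := fun M =>
  ∃ (d : ℕ) (X : ChainComplex A ℤ) (γ : X ⟶ inDegreeZero M),
    IsResolution 𝒳 X γ ∧ ∀ n : ℤ, (d : ℤ) < n → IsZero (X.X n)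

/-- `cores 𝒴^`: the objects of finite `𝒴`-injective dimension, that is, the objects with a
`𝒴`-coresolution `Y` such that, for some `d`, `Y_n = 0` for all `n < -d`. -/
def finiteInjDim (𝒴 : ObjectProperty A) : ObjectProperty A := fun N =>
  ∃ (d : ℕ) (Y : ChainComplex A ℤ) (δ : inDegreeZero N ⟶ Y),
    IsCoresolution 𝒴 Y δ ∧ ∀ n : ℤ, n < -(d : ℤ) → IsZero (Y.X n)

/-- A totally `𝒲`-acyclic complex: an exact (unbounded) complex of objects of `𝒲` that stays
exact under `Hom(W, -)` and `Hom(-, W)` for all `W` in `𝒲`. -/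
structure IsTotallyAcyclic (𝒲 : ObjectProperty A) (T : ChainComplex A ℤ) : Prop where
  mem : ∀ n : ℤ, 𝒲 (T.X n)
  exact : T.Acyclic
  hom_from_exact : ∀ W : A, 𝒲 W → (homFrom W T).Acyclic
  hom_to_exact : ∀ W : A, 𝒲 W → (homTo T W).Acyclic

/-- `𝒢(𝒲)`: the objects isomorphic to `Coker(T_1 → T_0)` for some totally `𝒲`-acyclic `T`. -/
def gorenstein (𝒲 : ObjectProperty A) : ObjectProperty A := fun M =>
  ∃ T : ChainComplex A ℤ, IsTotallyAcyclic 𝒲 T ∧ Nonempty (M ≅ cokernel (T.d 1 0))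

/-- A Tate `𝒲`-resolution `T → W → M`: `T` is totally `𝒲`-acyclic, `W → M` is a proper
`𝒲`-resolution, and `T_n → W_n` is an isomorphism for all large `n`. -/
structure TateResolution (𝒲 : ObjectProperty A) (M : A) where
  T : ChainComplex A ℤ
  W : ChainComplex A ℤ
  α : T ⟶ W
  γ : W ⟶ inDegreeZero M
  totallyAcyclic : IsTotallyAcyclic 𝒲 T
  proper : IsProperResolution 𝒲 W γ
  eventually_iso : ∃ d : ℤ, ∀ n : ℤ, d ≤ n → IsIso (α.f n)

/-- A Tate `𝒱`-coresolution `N → V → S`: `S` is totally `𝒱`-acyclic, `N → V` is a proper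
`𝒱`-coresolution, and `V_n → S_n` is an isomorphism for all sufficiently negative `n`. -/
structure TateCoresolution (𝒱 : ObjectProperty A) (N : A) where
  V : ChainComplex A ℤ
  S : ChainComplex A ℤ
  δ : inDegreeZero N ⟶ V
  β : V ⟶ S
  totallyAcyclic : IsTotallyAcyclic 𝒱 S
  proper : IsProperCoresolution 𝒱 V δ
  eventually_iso : ∃ d : ℤ, ∀ n : ℤ, n ≤ d → IsIso (β.f n)

/-- Tate cohomology of `(M, N)` relative to `𝒲` in the first variable, computed by a Tate
`𝒲`-resolution `T → W → M`: the group `H_{-n}(Hom(T, N))`. -/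
def TateResolution.tateExt {𝒲 : ObjectProperty A} {M : A} (R : TateResolution 𝒲 M) (N : A)
    (n : ℤ) : AddCommGrpCat.{v} :=
  (homTo R.T N).homology n

/-- Tate cohomology of `(M, N)` relative to `𝒱` in the second variable, computed by a Tate
`𝒱`-coresolution `N → V → S`: the group `H_{-n}(Hom(M, S))`. -/
def TateCoresolution.tateExt {𝒱 : ObjectProperty A} {N : A} (R : TateCoresolution 𝒱 N) (M : A)
    (n : ℤ) : AddCommGrpCat.{v} :=
  (homFrom M R.S).homology (-n)

/-- The vanishing, for all `n ≥ 1`, of the `n`-th Tate cohomology relative to `𝒲` in the first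
variable, on `𝒳 × 𝒴`. -/
def TateExtVanishesLeft (𝒲 𝒳 𝒴 : ObjectProperty A) : Prop :=
  ∀ ⦃M N : A⦄, 𝒳 M → 𝒴 N → ∀ (R : TateResolution 𝒲 M) (n : ℤ), 1 ≤ n → IsZero (R.tateExt N n)

/-- The vanishing, for all `n ≥ 1`, of the `n`-th Tate cohomology relative to `𝒱` in the second
variable, on `𝒳 × 𝒴`. -/
def TateExtVanishesRight (𝒱 𝒳 𝒴 : ObjectProperty A) : Prop :=
  ∀ ⦃M N : A⦄, 𝒳 M → 𝒴 N → ∀ (R : TateCoresolution 𝒱 N) (n : ℤ), 1 ≤ n → IsZero (R.tateExt M n)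

end

end RelTate

/-!
Let `M` have finite `𝒢(𝒲)`-projective dimension and finite `𝒱`-injective dimension. As every object
of `𝒢(𝒲)` embeds in an object of `𝒲` with cokernel in `𝒢(𝒲)`, the Auslander–Buchweitz construction
gives an exact sequence `0 → M → K → G → 0` in which `K` has a finite `𝒲`-resolution and `G` is
again iteratively coresolved by `𝒲`. Now `Extⁿ(Y, M)` vanishes for such coresolved `Y` and large
`n`, since `M` has a finite `𝒱`-coresolution and `Ext(Y, 𝒱) = 0`; as `Ext(𝒲, M) = 0`, dimension
shifting along the coresolution by `𝒲` brings this vanishing down to `Ext¹(G, M) = 0`. Hence `M` is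
a direct summand of `K`, and pulling back `0 → L → X → K → 0` with `X ∈ 𝒲` along `M → K` exhibits
the first syzygy `L` of `K` as a syzygy of `M` with respect to a direct summand of `X`.

The second inclusion is the same argument in the opposite category. To avoid comparing the `Ext`
groups of a category with those of its opposite, the argument uses only a self-dual list of
properties of the vanishing of `Ext`, collected in `IsExtVanishing`.
-/

namespace RelTate

section Exactness

variable {B : Type u} [Category.{v} B] [Abelian B] {X₁ X₂ X₃ Y : B}

lemma exact_comp_mono_iff {f : X₁ ⟶ X₂} {g : X₂ ⟶ X₃} (w : f ≫ g = 0) (i : X₃ ⟶ Y) [Mono i] :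
    (ShortComplex.mk f (g ≫ i) (by rw [reassoc_of% w, zero_comp])).Exact ↔
      (ShortComplex.mk f g w).Exact := by
  let φ : ShortComplex.mk f g w ⟶ ShortComplex.mk f (g ≫ i) (by rw [reassoc_of% w, zero_comp]) :=
    { τ₁ := 𝟙 _, τ₂ := 𝟙 _, τ₃ := i }
  have : Epi φ.τ₁ := inferInstanceAs (Epi (𝟙 _))
  have : IsIso φ.τ₂ := inferInstanceAs (IsIso (𝟙 _))
  have : Mono φ.τ₃ := inferInstanceAs (Mono i)
  exact (ShortComplex.exact_iff_of_epi_of_isIso_of_mono φ).symm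

lemma exact_epi_comp_iff {f : X₁ ⟶ X₂} {g : X₂ ⟶ X₃} (q : Y ⟶ X₁) [Epi q] (w : f ≫ g = 0) :
    (ShortComplex.mk (q ≫ f) g (by rw [Category.assoc, w, comp_zero])).Exact ↔
      (ShortComplex.mk f g w).Exact := by
  let φ : ShortComplex.mk (q ≫ f) g (by rw [Category.assoc, w, comp_zero]) ⟶
      ShortComplex.mk f g w := { τ₁ := q, τ₂ := 𝟙 _, τ₃ := 𝟙 _ }
  have : Epi φ.τ₁ := inferInstanceAs (Epi q)
  have : IsIso φ.τ₂ := inferInstanceAs (IsIso (𝟙 _))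
  have : Mono φ.τ₃ := inferInstanceAs (Mono (𝟙 _))
  exact ShortComplex.exact_iff_of_epi_of_isIso_of_mono φ

end Exactness

section ShortExactSequences

variable {B : Type u} [Category.{v} B] [Abelian B]

/-- There is a short exact sequence `0 → X → Y → Z → 0`. -/
def ShortExactSeq (X Y Z : B) : Prop :=
  ∃ (i : X ⟶ Y) (p : Y ⟶ Z) (w : i ≫ p = 0), (ShortComplex.mk i p w).ShortExact

lemma ShortExactSeq.of_shortExact {S : ShortComplex B} (hS : S.ShortExact) :
    ShortExactSeq S.X₁ S.X₂ S.X₃ :=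
  ⟨S.f, S.g, S.zero, hS⟩

lemma ShortExactSeq.of_iso {X Y Z X' Y' Z' : B} (h : ShortExactSeq X Y Z) (a : X ≅ X')
    (b : Y ≅ Y') (c : Z ≅ Z') : ShortExactSeq X' Y' Z' := by
  obtain ⟨i, p, w, h⟩ := h
  refine ⟨a.inv ≫ i ≫ b.hom, b.inv ≫ p ≫ c.hom, by simp [reassoc_of% w], ?_⟩
  exact ShortComplex.shortExact_of_iso (ShortComplex.isoMk a b c (by simp) (by simp)) h

lemma ShortExactSeq.op {X Y Z : B} (h : ShortExactSeq X Y Z) :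
    ShortExactSeq (op Z) (op Y) (op X) := by
  obtain ⟨i, p, w, h⟩ := h
  exact of_shortExact h.op

lemma ShortExactSeq.unop {X Y Z : Bᵒᵖ} (h : ShortExactSeq X Y Z) :
    ShortExactSeq Z.unop Y.unop X.unop := by
  obtain ⟨i, p, w, h⟩ := h
  exact of_shortExact h.unop

lemma shortExactSeq_cokernel {X Y : B} (i : X ⟶ Y) [Mono i] : ShortExactSeq X Y (cokernel i) :=
  ⟨i, cokernel.π i, cokernel.condition i, { exact := ShortComplex.exact_cokernel i }⟩

lemma exists_mono_of_shortExactSeq {X Y Z : B} (h : ShortExactSeq X Y Z) :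
    ∃ i : X ⟶ Y, Mono i ∧ Nonempty (cokernel i ≅ Z) := by
  obtain ⟨i, p, w, h⟩ := h
  exact ⟨i, h.mono_f,
    ⟨(cokernelIsCokernel i).coconePointUniqueUpToIso h.gIsCokernel⟩⟩

lemma ShortExactSeq.exists_pushout {X Y Z Y' Z' : B} (h : ShortExactSeq X Y Z)
    (h' : ShortExactSeq X Y' Z') : ∃ Q, ShortExactSeq Y Q Z' ∧ ShortExactSeq Y' Q Z := by
  obtain ⟨i, _, ⟨e⟩⟩ := exists_mono_of_shortExactSeq h
  obtain ⟨i', _, ⟨e'⟩⟩ := exists_mono_of_shortExactSeq h'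
  have sq := IsPushout.of_hasPushout i i'
  have := isIso_cokernel_map_of_isPushout sq
  have := isIso_cokernel_map_of_isPushout sq.flip
  exact ⟨pushout i i',
    (shortExactSeq_cokernel (pushout.inl i i')).of_iso (Iso.refl _) (Iso.refl _)
      ((asIso (cokernel.map _ _ _ _ sq.flip.w)).symm ≪≫ e'),
    (shortExactSeq_cokernel (pushout.inr i i')).of_iso (Iso.refl _) (Iso.refl _)
      ((asIso (cokernel.map _ _ _ _ sq.w)).symm ≪≫ e)⟩

lemma ShortExactSeq.comp_mono {X Y Z P R : B} (h : ShortExactSeq X Y P)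
    (h' : ShortExactSeq Y Z R) : ∃ Q, ShortExactSeq X Z Q ∧ ShortExactSeq P Q R := by
  obtain ⟨f, _, ⟨e⟩⟩ := exists_mono_of_shortExactSeq h
  obtain ⟨g, _, ⟨e'⟩⟩ := exists_mono_of_shortExactSeq h'
  have hfg := kernelCokernelCompSequence_exact f g
  refine ⟨cokernel (f ≫ g), shortExactSeq_cokernel (f ≫ g), ShortExactSeq.of_iso
    (of_shortExact (S := (kernelCokernelCompSequence f g).sc' hfg.toIsComplex 3 4 5) ?_)
    e (Iso.refl _) e'⟩
  exact { exact := hfg.exact 3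
          mono_f := (hfg.exact 2).mono_g ((isZero_kernel_of_mono g).eq_of_src _ _)
          epi_g := inferInstanceAs (Epi ((kernelCokernelCompSequence f g).map' 4 5)) }

lemma ShortExactSeq.comp_epi {L X K M G : B} (h : ShortExactSeq L X K)
    (h' : ShortExactSeq M K G) : ∃ Q, ShortExactSeq Q X G ∧ ShortExactSeq L Q M := by
  obtain ⟨Q, hQ, hQ'⟩ := h'.op.comp_mono h.op
  exact ⟨Q.unop, hQ.unop, hQ'.unop⟩

end ShortExactSequences

section FiniteResolutions

variable {B : Type u} [Category.{v} B] [Abelian B]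

/-- `M` has a finite resolution by objects of `P`, expressed through iterated syzygies. A finite
coresolution of `M` by objects of `P` is encoded as `FiniteRes P.op (op M)`. -/
inductive FiniteRes (P : ObjectProperty B) : B → Prop
  | of_mem {M : B} (hM : P M) : FiniteRes P M
  | of_shortExactSeq {K X M : B} (h : ShortExactSeq K X M) (hX : P X) (hK : FiniteRes P K) :
      FiniteRes P M

lemma FiniteRes.mono {P Q : ObjectProperty B} (hPQ : P ≤ Q) {M : B} (hM : FiniteRes P M) :
    FiniteRes Q M := by
  induction hM with
  | of_mem hM => exact .of_mem (hPQ _ hM)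
  | of_shortExactSeq h hX _ ih => exact .of_shortExactSeq h (hPQ _ hX) ih

end FiniteResolutions

section Orthogonality

variable {B : Type u} [Category.{v} B] {E : ℕ → B → B → Prop} {P Q V : ObjectProperty B}

/-- The orthogonality relation `P ⊥ Q` with respect to `E n X Y := (Extⁿ⁺¹(X, Y) = 0)`. -/
def Orthogonal (E : ℕ → B → B → Prop) (P Q : ObjectProperty B) : Prop :=
  ∀ ⦃X Y : B⦄, P X → Q Y → ∀ n, E n X Y

lemma Orthogonal.op (h : Orthogonal E P Q) :
    Orthogonal (fun n X Y => E n Y.unop X.unop) Q.op P.op :=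
  fun _ _ hX hY n => h hY hX n

lemma Orthogonal.sup_right (hP : Orthogonal E P Q) (hP' : Orthogonal E P V) :
    Orthogonal E P (Q ⊔ V) :=
  fun _ _ hX hY n => hY.elim (hP hX · n) (hP' hX · n)

end Orthogonality

section ExtVanishing

variable {B : Type u} [Category.{v} B] [Abelian B]

/-- The formal properties of the relation `E n X Y := (Extⁿ⁺¹(X, Y) = 0)`: what the long exact
sequences say about vanishing, and the splitting of extensions. They are self-dual, so that an
argument based on them applies to the opposite category. -/
structure IsExtVanishing (E : ℕ → B → B → Prop) : Prop where
  covariant₁ {X Y Z T : B} {n : ℕ} (h : ShortExactSeq X Y Z) (hZ : E n T Z)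
    (hY : E (n + 1) T Y) : E (n + 1) T X
  covariant₂ {X Y Z T : B} {n : ℕ} (h : ShortExactSeq X Y Z) (hX : E n T X) (hZ : E n T Z) :
    E n T Y
  covariant₃ {X Y Z T : B} {n : ℕ} (h : ShortExactSeq X Y Z) (hY : E n T Y)
    (hX : E (n + 1) T X) : E n T Z
  contravariant₁ {X Y Z T : B} {n : ℕ} (h : ShortExactSeq X Y Z) (hY : E n Y T)
    (hZ : E (n + 1) Z T) : E n X T
  contravariant₂ {X Y Z T : B} {n : ℕ} (h : ShortExactSeq X Y Z) (hX : E n X T) (hZ : E n Z T) :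
    E n Y T
  contravariant₃ {X Y Z T : B} {n : ℕ} (h : ShortExactSeq X Y Z) (hX : E n X T)
    (hY : E (n + 1) Y T) : E (n + 1) Z T
  splitting {S : ShortComplex B} (hS : S.ShortExact) (h : E 0 S.X₃ S.X₁) : Nonempty S.Splitting

variable {E : ℕ → B → B → Prop}

lemma IsExtVanishing.op (hE : IsExtVanishing E) :
    IsExtVanishing (B := Bᵒᵖ) (fun n X Y => E n Y.unop X.unop) where
  covariant₁ h := hE.contravariant₃ h.unop
  covariant₂ h hX hZ := hE.contravariant₂ h.unop hZ hX
  covariant₃ h := hE.contravariant₁ h.unop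
  contravariant₁ h := hE.covariant₃ h.unop
  contravariant₂ h hX hZ := hE.covariant₂ h.unop hZ hX
  contravariant₃ h := hE.covariant₁ h.unop
  splitting hS h := (hE.splitting hS.unop h).map ShortComplex.Splitting.op

lemma IsExtVanishing.retract (hE : IsExtVanishing E) {X Y Z : B} (h : ShortExactSeq X Y Z)
    (hZX : E 0 Z X) : Nonempty (Retract X Y) := by
  obtain ⟨i, p, w, h⟩ := h
  obtain ⟨s⟩ := hE.splitting h hZX
  exact ⟨⟨i, s.r, s.f_r⟩⟩

lemma IsExtVanishing.shortExactSeq_symm (hE : IsExtVanishing E) {X Y Z : B}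
    (h : ShortExactSeq X Y Z) (hZX : E 0 Z X) : ShortExactSeq Z Y X := by
  obtain ⟨i, p, w, h⟩ := h
  obtain ⟨s⟩ := hE.splitting h hZX
  have s' : (ShortComplex.mk s.s s.r s.s_r).Splitting :=
    { r := p
      s := i
      f_r := s.s_g
      s_g := s.f_r
      id := (add_comm _ _).trans s.id }
  exact .of_shortExact s'.shortExact

variable {P Q W U V : ObjectProperty B}

lemma Orthogonal.finiteRes (hE : IsExtVanishing E) (h : Orthogonal E P Q) :
    Orthogonal E P (FiniteRes Q) := by
  intro X Y hX hY n
  induction hY generalizing n with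
  | of_mem hY => exact h hX hY n
  | of_shortExactSeq hs hY _ ih => exact hE.covariant₃ hs (h hX hY n) (ih (n + 1))

lemma Orthogonal.exists_forall_ge (hE : IsExtVanishing E) (h : Orthogonal E P V) {N : Bᵒᵖ}
    (hN : FiniteRes V.op N) : ∃ d : ℕ, ∀ Y, P Y → ∀ n ≥ d, E n Y N.unop := by
  induction hN with
  | of_mem hN => exact ⟨0, fun Y hY n _ => h hY hN n⟩
  | of_shortExactSeq hs hX _ ih =>
    obtain ⟨d, hd⟩ := ih
    refine ⟨d + 1, fun Y hY n hn => ?_⟩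
    obtain ⟨m, rfl⟩ := Nat.exists_eq_add_of_le' (show 1 ≤ n by omega)
    exact hE.covariant₁ hs.unop (hd Y hY m (by omega)) (h hY hX (m + 1))

/-- Every object of `P` embeds in an object of `W` with cokernel in `P`. -/
def CoresolvedBy (W P : ObjectProperty B) : Prop :=
  ∀ ⦃Y : B⦄, P Y → ∃ X Z, W X ∧ P Z ∧ ShortExactSeq Y X Z

lemma CoresolvedBy.dimension_shift (hE : IsExtVanishing E) (hP : CoresolvedBy W P) {M : B}
    (hM : ∀ X, W X → ∀ n, E n X M) {d : ℕ} (hd : ∀ Y, P Y → ∀ n ≥ d, E n Y M) {Y : B}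
    (hY : P Y) (n : ℕ) : E n Y M := by
  obtain ⟨k, hk⟩ : ∃ k, d ≤ n + k := ⟨d, by omega⟩
  induction k generalizing Y n with
  | zero => exact hd Y hY n hk
  | succ k ih =>
    obtain ⟨X, Z, hX, hZ, h⟩ := hP hY
    exact hE.contravariant₁ h (hM X hX n) (ih hZ (n + 1) (by omega))

/-- The union of all classes coresolved by `W` and left orthogonal to `U`. It stands in for a class
such as `𝒢(W)` because its closure under extensions is formal, by maximality. -/
def maxCoresolved (E : ℕ → B → B → Prop) (W U : ObjectProperty B) : ObjectProperty B := fun Y =>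
  ∃ P : ObjectProperty B, CoresolvedBy W P ∧ Orthogonal E P U ∧ P Y

lemma le_maxCoresolved (hP : CoresolvedBy W P) (hPU : Orthogonal E P U) :
    P ≤ maxCoresolved E W U :=
  fun _ hY => ⟨P, hP, hPU, hY⟩

variable (E W U) in
lemma coresolvedBy_maxCoresolved : CoresolvedBy W (maxCoresolved E W U) := by
  rintro Y ⟨P, hP, hPU, hY⟩
  obtain ⟨X, Z, hX, hZ, h⟩ := hP hY
  exact ⟨X, Z, hX, le_maxCoresolved hP hPU Z hZ, h⟩

variable (E W U) in
lemma orthogonal_maxCoresolved : Orthogonal E (maxCoresolved E W U) U := by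
  rintro Y X ⟨P, -, hPU, hY⟩ hX
  exact hPU hY hX

/-- The objects which are extensions of two objects of `P`. -/
def extensions (P : ObjectProperty B) : ObjectProperty B := fun Y =>
  ∃ G G', P G ∧ P G' ∧ ShortExactSeq G Y G'

lemma Orthogonal.extensions (hE : IsExtVanishing E) (h : Orthogonal E P Q) :
    Orthogonal E (extensions P) Q := by
  rintro Y X ⟨G, G', hG, hG', hs⟩ hX n
  exact hE.contravariant₂ hs (h hG hX n) (h hG' hX n)

lemma CoresolvedBy.extensions [W.IsClosedUnderExtensions] (hE : IsExtVanishing E)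
    (hP : CoresolvedBy W P) (hPW : Orthogonal E P W) : CoresolvedBy W (extensions P) := by
  rintro Y ⟨G, G', hG, hG', h⟩
  obtain ⟨X, H, hX, hH, hs⟩ := hP hG
  obtain ⟨X', H', hX', hH', hs'⟩ := hP hG'
  obtain ⟨R, hYR, hXR⟩ := h.exists_pushout hs
  -- Since `Ext¹(G', X) = 0`, the roles of `X` and `G'` in `R` can be exchanged.
  obtain ⟨Q, hRQ, ⟨_, _, _, hQ⟩⟩ :=
    (hE.shortExactSeq_symm hXR (hPW hG' hX 0)).exists_pushout hs'
  obtain ⟨T, hYQ, hT⟩ := hYR.comp_mono hRQ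
  exact ⟨Q, T, W.prop_X₂_of_shortExact hQ hX' hX, ⟨H, H', hH, hH', hT⟩, hYQ⟩

lemma isClosedUnderExtensions_maxCoresolved [W.IsClosedUnderExtensions] (hE : IsExtVanishing E)
    (hWU : W ≤ U) : (maxCoresolved E W U).IsClosedUnderExtensions where
  prop_X₂_of_shortExact hS h₁ h₃ := by
    have hU := orthogonal_maxCoresolved E W U
    exact le_maxCoresolved
      ((coresolvedBy_maxCoresolved E W U).extensions hE fun _ _ hY hX => hU hY (hWU _ hX))
      (hU.extensions hE) _ ⟨_, _, h₁, h₃, .of_shortExact hS⟩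

lemma CoresolvedBy.exists_hull [P.IsClosedUnderExtensions] (hP : CoresolvedBy W P) {M : B}
    (hM : FiniteRes P M) : ∃ K G, FiniteRes W K ∧ P G ∧ ShortExactSeq M K G := by
  induction hM with
  | of_mem hM =>
    obtain ⟨X, Z, hX, hZ, h⟩ := hP hM
    exact ⟨X, Z, .of_mem hX, hZ, h⟩
  | of_shortExactSeq h hG _ ih =>
    obtain ⟨K', G', hK', hG', h'⟩ := ih
    obtain ⟨Q, ⟨_, _, _, hQ⟩, hQM⟩ := h.exists_pushout h'
    obtain ⟨X, Z, hX, hZ, hs⟩ := hP (P.prop_X₂_of_shortExact hQ hG hG')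
    obtain ⟨K, hK, hMK⟩ := hQM.comp_mono hs
    exact ⟨K, Z, .of_shortExactSeq hK hX hK', hZ, hMK⟩

lemma FiniteRes.left_of_shortExactSeq [W.IsStableUnderRetracts] (hE : IsExtVanishing E)
    (hQW : Orthogonal E Q W) {M K G : B} (hK : FiniteRes W K) (h : ShortExactSeq M K G)
    (hG : Q G) (hGM : E 0 G M) : FiniteRes W M := by
  cases hK with
  | of_mem hK =>
    obtain ⟨r⟩ := hE.retract h hGM
    exact .of_mem (W.prop_of_retract r hK)
  | of_shortExactSeq hs hX hL =>
    obtain ⟨R, hRX, hLR⟩ := hs.comp_epi h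
    obtain ⟨r⟩ := hE.retract hRX (hE.covariant₂ hLR (hQW.finiteRes hE hG hL 0) hGM)
    exact .of_shortExactSeq hLR (W.prop_of_retract r hX) hL

theorem finiteRes_of_coresolvedBy [W.IsClosedUnderExtensions] [W.IsStableUnderRetracts]
    (hE : IsExtVanishing E) (hP : CoresolvedBy W P) (hPWV : Orthogonal E P (W ⊔ V))
    (hWP : Orthogonal E W P) {M : B} (hM : FiniteRes P M) (hM' : FiniteRes V.op (op M)) :
    FiniteRes W M := by
  have hC := coresolvedBy_maxCoresolved E W (W ⊔ V)
  have hCWV := orthogonal_maxCoresolved E W (W ⊔ V)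
  have hCW : Orthogonal E (maxCoresolved E W (W ⊔ V)) W := fun _ _ hY hX => hCWV hY (.inl hX)
  have hCV : Orthogonal E (maxCoresolved E W (W ⊔ V)) V := fun _ _ hY hX => hCWV hY (.inr hX)
  have := isClosedUnderExtensions_maxCoresolved hE (le_sup_left (a := W) (b := V))
  obtain ⟨K, G, hK, hG, h⟩ := hC.exists_hull (hM.mono (le_maxCoresolved hP hPWV))
  obtain ⟨d, hd⟩ := hCV.exists_forall_ge hE hM'
  have hCM : ∀ {Y}, maxCoresolved E W (W ⊔ V) Y → ∀ n, E n Y M :=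
    hC.dimension_shift hE (fun X hX => hWP.finiteRes hE hX hM) hd
  exact hK.left_of_shortExactSeq hE hCW h hG (hCM hG 0)

end ExtVanishing

section Ext

variable {A : Type u} [Category.{v} A] [Abelian A] [HasExt.{w} A]

/-- The relation `Extⁿ⁺¹(X, Y) = 0`. -/
def ExtVanishes (n : ℕ) (X Y : A) : Prop :=
  Subsingleton (Abelian.Ext.{w} X Y (n + 1))

lemma Perp.orthogonal {P Q : ObjectProperty A} (h : Perp.{w} P Q) :
    Orthogonal ExtVanishes.{w} P Q :=
  fun _ _ hX hY n => h hX hY (n + 1) (by omega)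

lemma extVanishes_of_forall {X Y : A} {n : ℕ} (h : ∀ x : Abelian.Ext.{w} X Y (n + 1), x = 0) :
    ExtVanishes.{w} n X Y :=
  ⟨fun a b => (h a).trans (h b).symm⟩

lemma ExtVanishes.eq_zero {X Y : A} {n : ℕ} (h : ExtVanishes.{w} n X Y)
    (x : Abelian.Ext.{w} X Y (n + 1)) : x = 0 :=
  Subsingleton.elim (h := h) _ _

lemma ExtVanishes.of_iso {X X' Y Y' : A} {n : ℕ} (h : ExtVanishes.{w} n X Y) (e : X ≅ X')
    (e' : Y ≅ Y') : ExtVanishes.{w} n X' Y' := by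
  refine extVanishes_of_forall fun x => ?_
  let y : Abelian.Ext.{w} X Y (n + 1) :=
    (Abelian.Ext.mk₀ e.hom).comp (x.comp (.mk₀ e'.inv) (add_zero _)) (zero_add _)
  have hx : x = (Abelian.Ext.mk₀ e.inv).comp (y.comp (.mk₀ e'.hom) (add_zero _)) (zero_add _) := by
    simp [y]
  rw [hx, h.eq_zero y, Abelian.Ext.zero_comp, Abelian.Ext.comp_zero]

lemma extVanishes_zero_of_lift {S : ShortComplex A} (hS : S.ShortExact) {T : A}
    (hlift : ∀ f : T ⟶ S.X₃, ∃ g : T ⟶ S.X₂, g ≫ S.g = f) (h : ExtVanishes.{w} 0 T S.X₂) :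
    ExtVanishes.{w} 0 T S.X₁ := by
  refine extVanishes_of_forall fun x => ?_
  obtain ⟨y, rfl⟩ := Abelian.Ext.covariant_sequence_exact₁ T hS x (h.eq_zero _) (zero_add 1)
  obtain ⟨f, rfl⟩ := (Abelian.Ext.mk₀_bijective _ _).2 y
  obtain ⟨g, rfl⟩ := hlift f
  rw [← Abelian.Ext.mk₀_comp_mk₀, Abelian.Ext.comp_assoc_of_second_deg_zero, hS.comp_extClass,
    Abelian.Ext.comp_zero]

lemma extVanishes_zero_of_extend {S : ShortComplex A} (hS : S.ShortExact) {T : A}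
    (hext : ∀ f : S.X₁ ⟶ T, ∃ g : S.X₂ ⟶ T, S.f ≫ g = f) (h : ExtVanishes.{w} 0 S.X₂ T) :
    ExtVanishes.{w} 0 S.X₃ T := by
  refine extVanishes_of_forall fun x => ?_
  obtain ⟨y, rfl⟩ := Abelian.Ext.contravariant_sequence_exact₃ hS T x (h.eq_zero _) (add_zero 1)
  obtain ⟨f, rfl⟩ := (Abelian.Ext.mk₀_bijective _ _).2 y
  obtain ⟨g, rfl⟩ := hext f
  rw [← Abelian.Ext.mk₀_comp_mk₀, hS.extClass_comp_assoc]

lemma ExtVanishes.splitting {S : ShortComplex A} (hS : S.ShortExact)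
    (h : ExtVanishes.{w} 0 S.X₃ S.X₁) : Nonempty S.Splitting := by
  obtain ⟨x, hx⟩ := Abelian.Ext.covariant_sequence_exact₃ S.X₃ hS (Abelian.Ext.mk₀.{w} (𝟙 S.X₃))
    (zero_add 1) (h.eq_zero _)
  obtain ⟨s, rfl⟩ := (Abelian.Ext.mk₀_bijective _ _).2 x
  rw [Abelian.Ext.mk₀_comp_mk₀] at hx
  exact ⟨.ofExactOfSection _ hS.exact s ((Abelian.Ext.mk₀_bijective _ _).1 hx) hS.mono_f⟩

variable (A) in
lemma isExtVanishing_extVanishes : IsExtVanishing (B := A) ExtVanishes.{w} where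
  covariant₁ := by
    rintro X Y Z T n ⟨i, p, w, h⟩ hZ hY
    refine extVanishes_of_forall fun x => ?_
    obtain ⟨y, rfl⟩ := Abelian.Ext.covariant_sequence_exact₁ T h x (hY.eq_zero _) rfl
    rw [hZ.eq_zero y, Abelian.Ext.zero_comp]
  covariant₂ := by
    rintro X Y Z T n ⟨i, p, w, h⟩ hX hZ
    refine extVanishes_of_forall fun x => ?_
    obtain ⟨y, rfl⟩ := Abelian.Ext.covariant_sequence_exact₂ T h x (hZ.eq_zero _)
    rw [hX.eq_zero y, Abelian.Ext.zero_comp]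
  covariant₃ := by
    rintro X Y Z T n ⟨i, p, w, h⟩ hY hX
    refine extVanishes_of_forall fun x => ?_
    obtain ⟨y, rfl⟩ := Abelian.Ext.covariant_sequence_exact₃ T h x rfl (hX.eq_zero _)
    rw [hY.eq_zero y, Abelian.Ext.zero_comp]
  contravariant₁ := by
    rintro X Y Z T n ⟨i, p, w, h⟩ hY hZ
    refine extVanishes_of_forall fun x => ?_
    obtain ⟨y, rfl⟩ := Abelian.Ext.contravariant_sequence_exact₁ h T x (add_comm 1 (n + 1))
      (hZ.eq_zero _)
    rw [hY.eq_zero y, Abelian.Ext.comp_zero]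
  contravariant₂ := by
    rintro X Y Z T n ⟨i, p, w, h⟩ hX hZ
    refine extVanishes_of_forall fun x => ?_
    obtain ⟨y, rfl⟩ := Abelian.Ext.contravariant_sequence_exact₂ h T x (hX.eq_zero _)
    rw [hZ.eq_zero y, Abelian.Ext.comp_zero]
  contravariant₃ := by
    rintro X Y Z T n ⟨i, p, w, h⟩ hX hY
    refine extVanishes_of_forall fun x => ?_
    obtain ⟨y, rfl⟩ := Abelian.Ext.contravariant_sequence_exact₃ h T x (hY.eq_zero _)
      (add_comm 1 (n + 1))
    rw [hX.eq_zero y, Abelian.Ext.comp_zero]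
  splitting := ExtVanishes.splitting

end Ext

section Reindexing

variable {C : Type*} [Category* C] [HasZeroMorphisms C] {ι ι' : Type*} {c : ComplexShape ι}
  {c' : ComplexShape ι'}

lemma acyclic_restriction {K : HomologicalComplex C c'} (hK : K.Acyclic) (e : c.Embedding c')
    [e.IsTruncGE] [e.IsTruncLE] : (K.restriction e).Acyclic := fun i =>
  (K.exactAt_iff' _ _ _ (e.prev_f rfl) (e.next_f rfl)).1 (hK (e.f i))

instance quasiIso_restrictionMap [CategoryWithHomology C] {K L : HomologicalComplex C c'}
    (φ : K ⟶ L) [QuasiIso φ] (e : c.Embedding c') [e.IsTruncGE] [e.IsTruncLE] :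
    QuasiIso (HomologicalComplex.restrictionMap φ e) where
  quasiIsoAt _ := (quasiIsoAt_iff' _ _ _ _ rfl rfl).2
    ((quasiIsoAt_iff' φ _ _ _ (e.prev_f rfl) (e.next_f rfl)).1 inferInstance)

/-- The automorphism `n ↦ n + k` of the shape of `ℤ`-indexed chain complexes. -/
def translation (k : ℤ) : (ComplexShape.down ℤ).Embedding (ComplexShape.down ℤ) :=
  ComplexShape.embeddingDown'Add 1 k

instance (k : ℤ) : (translation k).IsTruncLE :=
  inferInstanceAs (ComplexShape.embeddingDown'Add 1 k).IsTruncLE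

instance (k : ℤ) : (translation k).IsTruncGE where
  mem_next {j i} (h : i + 1 = j + k) := ⟨j - 1, show j - 1 + k = i by omega⟩

end Reindexing

section Opcycles

variable {A : Type u} [Category.{v} A] [Abelian A] {ι : Type*} {c : ComplexShape ι}
  {K : HomologicalComplex A c} {i j : ι}

lemma mono_fromOpcycles (hij : c.Rel i j) (hK : K.ExactAt i) : Mono (K.fromOpcycles i j) :=
  Preadditive.mono_of_isZero_kernel' _ (K.homologyIsKernel i j (c.next_eq' hij)) hK.isZero_homology

/-- `0 ⟶ Coker(K_h ⟶ K_i) ⟶ K_j ⟶ Coker(K_i ⟶ K_j) ⟶ 0`. -/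
noncomputable abbrev opcyclesSequence (K : HomologicalComplex A c) (i j : ι) : ShortComplex A :=
  .mk (K.fromOpcycles i j) (K.pOpcycles j) (by simp [← cancel_epi (K.pOpcycles i)])

lemma opcyclesSequence_shortExact (hij : c.Rel i j) (hK : K.ExactAt i) :
    (opcyclesSequence K i j).ShortExact where
  exact := by
    rw [← exact_epi_comp_iff (K.pOpcycles i)]
    simpa using ShortComplex.exact_of_g_is_cokernel (.mk _ _ (K.d_pOpcycles i j))
      (K.opcyclesIsCokernel i j (c.prev_eq' hij))
  mono_f := mono_fromOpcycles hij hK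

end Opcycles

section Gorenstein

variable {A : Type u} [Category.{v} A] [Abelian A] {W : ObjectProperty A}

lemma exists_comp_d_eq {T : ChainComplex A ℤ} {X : A} (h : (homFrom X T).Acyclic) {i j k : ℤ}
    (hij : j + 1 = i) (hjk : k + 1 = j) (φ : X ⟶ T.X j) (hφ : φ ≫ T.d j k = 0) :
    ∃ ψ : X ⟶ T.X i, ψ ≫ T.d i j = φ := by
  have h' := h j
  rw [HomologicalComplex.exactAt_iff' _ i j k (ComplexShape.prev_eq' _ hij)
    (ComplexShape.next_eq' _ hjk), ShortComplex.ab_exact_iff] at h'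
  exact h' φ hφ

lemma exists_d_comp_eq {T : ChainComplex A ℤ} {X : A} (h : (homTo T X).Acyclic) {i j k : ℤ}
    (hij : j + 1 = i) (hjk : k + 1 = j) (φ : T.X j ⟶ X) (hφ : T.d i j ≫ φ = 0) :
    ∃ ψ : T.X k ⟶ X, T.d j k ≫ ψ = φ := by
  have h' := h j
  rw [HomologicalComplex.exactAt_iff' _ k j i (ComplexShape.prev_eq' _ hjk)
    (ComplexShape.next_eq' _ hij), ShortComplex.ab_exact_iff] at h'
  exact h' φ hφ

instance : (gorenstein W).IsClosedUnderIsomorphisms where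
  of_iso e := by
    rintro ⟨T, hT, ⟨a⟩⟩
    exact ⟨T, hT, ⟨e.symm ≪≫ a⟩⟩

namespace IsTotallyAcyclic

variable {T : ChainComplex A ℤ}

lemma reindex (hT : IsTotallyAcyclic W T) (k : ℤ) :
    IsTotallyAcyclic W (T.restriction (translation k)) where
  mem n := hT.mem (n + k)
  exact := acyclic_restriction hT.exact _
  hom_from_exact X hX := acyclic_restriction (hT.hom_from_exact X hX) (translation k)
  hom_to_exact X hX := acyclic_restriction (hT.hom_to_exact X hX) (translation k).op

lemma gorenstein_opcycles (hT : IsTotallyAcyclic W T) (n : ℤ) : gorenstein W (T.opcycles n) := by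
  let e := T.restrictionOpcyclesIso (translation n) 1 0 (by simp) rfl (j' := n) (zero_add n)
    (by simp [translation, add_comm])
  exact ⟨_, hT.reindex n, ⟨e.symm ≪≫ ((T.restriction (translation n)).opcyclesIsCokernel 1 0
    (by simp)).coconePointUniqueUpToIso (colimit.isColimit _)⟩⟩

lemma shortExact (hT : IsTotallyAcyclic W T) {i j : ℤ} (hij : j + 1 = i) :
    (opcyclesSequence T i j).ShortExact :=
  opcyclesSequence_shortExact hij (hT.exact _)

lemma exists_lift (hT : IsTotallyAcyclic W T) {X : A} (hX : W X) {n : ℤ}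
    (f : X ⟶ T.opcycles n) : ∃ g : X ⟶ T.X n, g ≫ T.pOpcycles n = f := by
  have := mono_fromOpcycles (K := T) (i := n) (j := n - 1) (by simp) (hT.exact n)
  obtain ⟨g, hg⟩ := exists_comp_d_eq (hT.hom_from_exact X hX) (sub_add_cancel n 1)
    (sub_add_cancel (n - 1) 1) (f ≫ T.fromOpcycles n (n - 1)) (by simp)
  exact ⟨g, by simp [← cancel_mono (T.fromOpcycles n (n - 1)), hg]⟩

lemma exists_extension (hT : IsTotallyAcyclic W T) {X : A} (hX : W X) {i j : ℤ}
    (hij : j + 1 = i) (f : T.opcycles i ⟶ X) : ∃ g : T.X j ⟶ X, T.fromOpcycles i j ≫ g = f := by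
  obtain ⟨g, hg⟩ := exists_d_comp_eq (hT.hom_to_exact X hX) rfl hij (T.pOpcycles i ≫ f) (by simp)
  exact ⟨g, by simp [← cancel_epi (T.pOpcycles i), hg]⟩

end IsTotallyAcyclic

lemma exists_opcycles_iso_of_gorenstein {M : A} (hM : gorenstein W M) :
    ∃ T : ChainComplex A ℤ, IsTotallyAcyclic W T ∧ Nonempty (T.opcycles 0 ≅ M) := by
  obtain ⟨T, hT, ⟨e⟩⟩ := hM
  exact ⟨T, hT, ⟨(T.opcyclesIsCokernel 1 0 (by simp)).coconePointUniqueUpToIso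
    (colimit.isColimit _) ≪≫ e.symm⟩⟩

lemma coresolvedBy_gorenstein : CoresolvedBy W (gorenstein W) := by
  intro M hM
  obtain ⟨T, hT, ⟨e⟩⟩ := exists_opcycles_iso_of_gorenstein hM
  exact ⟨T.X (-1), T.opcycles (-1), hT.mem _, hT.gorenstein_opcycles _,
    (ShortExactSeq.of_shortExact (hT.shortExact rfl)).of_iso e (Iso.refl _) (Iso.refl _)⟩

lemma coresolvedBy_op_gorenstein : CoresolvedBy W.op (gorenstein W).op := by
  intro M hM
  obtain ⟨T, hT, ⟨e⟩⟩ := exists_opcycles_iso_of_gorenstein hM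
  exact ⟨op (T.X 0), op (T.opcycles 1), hT.mem _, hT.gorenstein_opcycles _,
    ((ShortExactSeq.of_shortExact (hT.shortExact rfl)).of_iso (Iso.refl _) (Iso.refl _) e).op⟩

variable [HasExt.{w} A]

namespace IsTotallyAcyclic

variable {T : ChainComplex A ℤ} {X : A}

lemma extVanishes_opcycles_left (hT : IsTotallyAcyclic W T)
    (hW : Orthogonal ExtVanishes.{w} W W) (hX : W X) (n : ℕ) (k : ℤ) :
    ExtVanishes.{w} n (T.opcycles k) X := by
  induction n generalizing k with
  | zero =>
    exact extVanishes_zero_of_extend (hT.shortExact (i := k + 1) rfl)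
      (hT.exists_extension hX rfl) (hW (hT.mem k) hX 0)
  | succ n ih =>
    exact (isExtVanishing_extVanishes A).contravariant₃
      (.of_shortExact (hT.shortExact (j := k) rfl)) (ih (k + 1)) (hW (hT.mem k) hX (n + 1))

lemma extVanishes_opcycles_right (hT : IsTotallyAcyclic W T)
    (hW : Orthogonal ExtVanishes.{w} W W) (hX : W X) (n : ℕ) (k : ℤ) :
    ExtVanishes.{w} n X (T.opcycles k) := by
  have h (k : ℤ) := hT.shortExact (sub_add_cancel k 1)
  induction n generalizing k with
  | zero => exact extVanishes_zero_of_lift (h k) (hT.exists_lift hX) (hW hX (hT.mem (k - 1)) 0)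
  | succ n ih =>
    exact (isExtVanishing_extVanishes A).covariant₁ (.of_shortExact (h k)) (ih (k - 1))
      (hW hX (hT.mem (k - 1)) (n + 1))

end IsTotallyAcyclic

lemma orthogonal_gorenstein_left (hW : Orthogonal ExtVanishes.{w} W W) :
    Orthogonal ExtVanishes.{w} (gorenstein W) W := by
  intro M X hM hX n
  obtain ⟨T, hT, ⟨e⟩⟩ := exists_opcycles_iso_of_gorenstein hM
  exact (hT.extVanishes_opcycles_left hW hX n 0).of_iso e (Iso.refl X)

lemma orthogonal_gorenstein_right (hW : Orthogonal ExtVanishes.{w} W W) :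
    Orthogonal ExtVanishes.{w} W (gorenstein W) := by
  intro X M hX hM n
  obtain ⟨T, hT, ⟨e⟩⟩ := exists_opcycles_iso_of_gorenstein hM
  exact (hT.extVanishes_opcycles_right hW hX n 0).of_iso (Iso.refl X) e

end Gorenstein

section ProjectiveDimension

variable {A : Type u} [Category.{v} A] [Abelian A] {P : ObjectProperty A}

lemma FiniteRes.of_iso [P.IsClosedUnderIsomorphisms] {M N : A} (hM : FiniteRes P M) (e : M ≅ N) :
    FiniteRes P N := by
  cases hM with
  | of_mem hM => exact .of_mem (P.prop_of_iso e hM)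
  | of_shortExactSeq h hX hK =>
    exact .of_shortExactSeq (h.of_iso (Iso.refl _) (Iso.refl _) e) hX hK

lemma finiteRes_opcycles [P.IsClosedUnderIsomorphisms] {X : ChainComplex A ℤ}
    (hX : ∀ n, P (X.X n)) (hexact : ∀ n > 0, X.ExactAt n) {d : ℤ} (hd : ∀ n > d, IsZero (X.X n))
    {n : ℤ} (hn : 0 ≤ n) : FiniteRes P (X.opcycles n) := by
  obtain ⟨k, hk⟩ : ∃ k : ℕ, d ≤ n + k := ⟨(d - n).toNat, by omega⟩
  induction k generalizing n with
  | zero =>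
    have := X.isIso_pOpcycles (n + 1) n (by simp) ((hd (n + 1) (by omega)).eq_of_src _ _)
    exact .of_mem (P.prop_of_iso (asIso (X.pOpcycles n)) (hX n))
  | succ k ih =>
    exact .of_shortExactSeq
      (.of_shortExact (opcyclesSequence_shortExact rfl (hexact (n + 1) (by omega)))) (hX n)
      (ih (by omega) (by push_cast at hk; omega))

lemma finiteRes_of_finiteProjDim [P.IsClosedUnderIsomorphisms] {M : A}
    (hM : finiteProjDim P M) : FiniteRes P M := by
  obtain ⟨d, X, γ, ⟨hX, hneg, _⟩, hd⟩ := hM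
  have hexact (n : ℤ) (hn : n > 0) : X.ExactAt n :=
    (exactAt_iff_of_quasiIsoAt γ n).2 (HomologicalComplex.exactAt_single_obj _ _ _ _ hn.ne')
  let e : X.opcycles 0 ≅ M :=
    (X.isoHomologyι 0 (-1) (by simp) ((hneg (-1) (by simp)).eq_of_tgt _ _)).symm ≪≫
      isoOfQuasiIsoAt γ 0 ≪≫ HomologicalComplex.singleObjHomologySelfIso _ _ _
  exact (finiteRes_opcycles hX hexact hd le_rfl).of_iso e

lemma exactAt_one_augment {Y : ChainComplex A ℕ} {X : A} {f : Y.X 0 ⟶ X} (w : Y.d 1 0 ≫ f = 0)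
    (h : (ShortComplex.mk _ f w).Exact) : (Y.augment f w).ExactAt 1 := by
  rw [HomologicalComplex.exactAt_iff' _ 2 1 0 (by simp) (by simp)]
  exact h

lemma exactAt_augment {Y : ChainComplex A ℕ} {X : A} {f : Y.X 0 ⟶ X} (w : Y.d 1 0 ≫ f = 0)
    {n : ℕ} (h : Y.ExactAt (n + 1)) : (Y.augment f w).ExactAt (n + 2) := by
  rw [HomologicalComplex.exactAt_iff' _ (n + 3) (n + 2) (n + 1) (by simp) (by simp)]
  exact (Y.exactAt_iff' (n + 2) (n + 1) n (by simp) (by simp)).1 h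

lemma exists_augmented_of_finiteRes [P.IsClosedUnderIsomorphisms] [P.ContainsZero] {M : A}
    (hM : FiniteRes P M) : ∃ (d : ℕ) (X : ChainComplex A ℕ) (p : X.X 0 ⟶ M) (w : X.d 1 0 ≫ p = 0),
      (∀ n, P (X.X n)) ∧ (∀ n > d, IsZero (X.X n)) ∧ (∀ n, X.ExactAt (n + 1)) ∧
        (ShortComplex.mk _ p w).Exact ∧ Epi p := by
  induction hM with
  | @of_mem M hM =>
    have hzero (n : ℕ) (hn : n > 0) : IsZero (((ChainComplex.single₀ A).obj M).X n) :=
      HomologicalComplex.isZero_single_obj_X _ _ _ _ hn.ne'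
    refine ⟨0, (ChainComplex.single₀ A).obj M, 𝟙 M, (hzero 1 one_pos).eq_of_src _ _,
      fun n => ?_, hzero, fun n => ChainComplex.exactAt_succ_single_obj M n, ?_,
      inferInstanceAs (Epi (𝟙 M))⟩
    · cases n with
      | zero => exact hM
      | succ n => exact P.prop_of_isZero (hzero _ n.succ_pos)
    · exact (ShortComplex.exact_iff_mono _ ((hzero 1 one_pos).eq_of_src _ _)).2
        (inferInstanceAs (Mono (𝟙 M)))
  | @of_shortExactSeq K X M h hX _ ih =>
    obtain ⟨i, p, w, h⟩ := h
    obtain ⟨d, Y, q, w', hY, hd, hexact, hq, _⟩ := ih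
    have := h.mono_f
    have hw' : Y.d 1 0 ≫ q ≫ i = 0 := by rw [reassoc_of% w', zero_comp]
    have hw : (q ≫ i) ≫ p = 0 := by simp [w]
    refine ⟨d + 1, Y.augment (q ≫ i) hw', p, hw, ?_, ?_, ?_,
      (exact_epi_comp_iff q w).2 h.exact, h.epi_g⟩
    · rintro (_ | n)
      exacts [hX, hY n]
    · rintro (_ | n) hn
      exacts [absurd hn (by simp), hd n (by omega)]
    · rintro (_ | n)
      exacts [exactAt_one_augment hw' ((exact_comp_mono_iff w' i).2 hq),
        exactAt_augment hw' (hexact n)]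

lemma quasiIso_of_exact {X : ChainComplex A ℕ} (hX : ∀ n, X.ExactAt (n + 1)) {M : A}
    (π : X ⟶ (ChainComplex.single₀ A).obj M) (w : X.d 1 0 ≫ π.f 0 = 0)
    (hπ : (ShortComplex.mk _ (π.f 0) w).Exact) (hepi : Epi (π.f 0)) : QuasiIso π where
  quasiIsoAt
    | 0 => by
      rw [ChainComplex.quasiIsoAt₀_iff,
        ShortComplex.quasiIso_iff_of_zeros' _ (X.shape 0 0 (by simp)) rfl rfl]
      exact ⟨hπ, hepi⟩
    | n + 1 => (quasiIsoAt_iff_exactAt' _ _ (ChainComplex.exactAt_succ_single_obj M n)).2 (hX n)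

/-- The inclusion of `ℕ`-indexed chain complexes into `ℤ`-indexed ones. -/
def natEmbedding : (ComplexShape.down ℕ).Embedding (ComplexShape.down ℤ) :=
  .mk' _ _ (fun n => n) Nat.cast_injective
    (fun i j => show j + 1 = i ↔ (j : ℤ) + 1 = i by omega)

instance : natEmbedding.IsRelIff where
  rel' i j (h : (j : ℤ) + 1 = i) := show j + 1 = i by omega

lemma finiteProjDim_of_finiteRes [P.IsClosedUnderIsomorphisms] [P.ContainsZero] {M : A}
    (hM : FiniteRes P M) : finiteProjDim P M := by
  obtain ⟨d, X, p, w, hX, hd, hexact, hp, hepi⟩ := exists_augmented_of_finiteRes hM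
  obtain ⟨π, rfl⟩ : ∃ π : X ⟶ (ChainComplex.single₀ A).obj M, π.f 0 = p :=
    ⟨(X.toSingle₀Equiv M).symm ⟨p, w⟩, by simp⟩
  have := quasiIso_of_exact hexact π w hp hepi
  have hneg (n : ℤ) (hn : n < 0) : IsZero ((X.extend natEmbedding).X n) :=
    X.isZero_extend_X _ _ fun i (hi : (i : ℤ) = n) => by omega
  let e (n : ℕ) : (X.extend natEmbedding).X n ≅ X.X n := X.extendXIso natEmbedding rfl
  let γ : X.extend natEmbedding ⟶ inDegreeZero M :=
    HomologicalComplex.extendMap π natEmbedding ≫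
      (HomologicalComplex.extendSingleIso natEmbedding M 0 0 rfl).hom
  refine ⟨d, X.extend natEmbedding, γ, ⟨fun n => ?_, hneg, inferInstance⟩, fun n hn => ?_⟩
  · obtain hn | hn := lt_or_ge n 0
    · exact P.prop_of_isZero (hneg n hn)
    · lift n to ℕ using hn
      exact P.prop_of_iso (e n).symm (hX n)
  · lift n to ℕ using by omega
    exact (hd n (by omega)).of_iso (e n)

end ProjectiveDimension

section InjectiveDimension

variable {A : Type u} [Category.{v} A] [Abelian A]

lemma exists_iso_inDegreeZero {L : ChainComplex A ℤ} (hL : ∀ n ≠ 0, IsZero (L.X n)) {M : A}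
    (e : L.X 0 ≅ M) : Nonempty (L ≅ inDegreeZero M) := by
  let φ : L ⟶ inDegreeZero M := HomologicalComplex.mkHomToSingle e.hom fun n hn =>
    (hL n (by rintro rfl; simp at hn)).eq_of_src _ _
  have (n : ℤ) : IsIso (φ.f n) := by
    obtain rfl | hn := eq_or_ne n 0
    · rw [HomologicalComplex.mkHomToSingle_f]
      infer_instance
    · exact (hL n hn).isIso (HomologicalComplex.isZero_single_obj_X _ _ _ _ hn) _
  have := HomologicalComplex.Hom.isIso_of_components φ
  exact ⟨asIso φ⟩

/-- Negation of degrees identifies the shape of `ℤ`-indexed chain complexes with its opposite. -/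
def negation : (ComplexShape.down ℤ).Embedding (ComplexShape.down ℤ).symm :=
  .mk' _ _ (fun n => -n) neg_injective (fun i j => show j + 1 = i ↔ -i + 1 = -j by omega)

instance : negation.IsTruncGE where
  rel' i j (h : -i + 1 = -j) := show j + 1 = i by omega
  mem_next {_ k} _ := ⟨-k, neg_neg k⟩

instance : negation.IsTruncLE where
  rel' i j (h : -i + 1 = -j) := show j + 1 = i by omega
  mem_prev {j _} _ := ⟨-j, neg_neg j⟩

lemma finiteProjDim_op {P : ObjectProperty A} {N : A} (hN : finiteInjDim P N) :
    finiteProjDim P.op (op N) := by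
  obtain ⟨d, Y, δ, ⟨hY, hpos, _⟩, hd⟩ := hN
  obtain ⟨e⟩ := exists_iso_inDegreeZero
    (L := (inDegreeZero N).op.restriction negation) (M := op N)
    (fun n hn => (HomologicalComplex.isZero_single_obj_X _ _ _ _ (neg_ne_zero.2 hn)).op)
    (HomologicalComplex.singleObjXSelf _ 0 N).symm.op
  let φ : Y.op.restriction negation ⟶ (inDegreeZero N).op.restriction negation :=
    HomologicalComplex.restrictionMap ((HomologicalComplex.opFunctor A _).map δ.op) negation
  have : QuasiIso ((HomologicalComplex.opFunctor A _).map δ.op) := inferInstance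
  have : QuasiIso φ := quasiIso_restrictionMap _ negation
  exact ⟨d, Y.op.restriction negation, φ ≫ e.hom,
    ⟨fun n => hY (-n), fun n hn => (hpos (-n) (by omega)).op, inferInstance⟩,
    fun n hn => (hd (-n) (by omega)).op⟩

lemma finiteInjDim_of_op {P : ObjectProperty A} {N : A} (hN : finiteProjDim P.op (op N)) :
    finiteInjDim P N := by
  obtain ⟨d, X, γ, ⟨hX, hneg, _⟩, hd⟩ := hN
  obtain ⟨e⟩ := exists_iso_inDegreeZero
    (L := (inDegreeZero (op N)).unop.restriction negation) (M := N)
    (fun n hn => (HomologicalComplex.isZero_single_obj_X _ _ _ _ (neg_ne_zero.2 hn)).unop)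
    (HomologicalComplex.singleObjXSelf _ 0 (op N)).symm.unop
  let φ : (inDegreeZero (op N)).unop.restriction negation ⟶ X.unop.restriction negation :=
    HomologicalComplex.restrictionMap ((HomologicalComplex.unopFunctor A _).map γ.op) negation
  have : QuasiIso ((HomologicalComplex.unopFunctor A _).map γ.op) := inferInstance
  have : QuasiIso φ := quasiIso_restrictionMap _ negation
  exact ⟨d, X.unop.restriction negation, e.inv ≫ φ,
    ⟨fun n => hX (-n), fun n hn => (hneg (-n) (by omega)).unop, inferInstance⟩,
    fun n hn => (hd (-n) (by omega)).unop⟩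

end InjectiveDimension

section Closure

variable {B : Type u} [Category.{v} B] [Abelian B]

lemma isClosedUnderExtensions_of_orthogonal {E : ℕ → B → B → Prop} (hE : IsExtVanishing E)
    (P : ObjectProperty B) [P.IsClosedUnderIsomorphisms] [P.IsClosedUnderFiniteProducts]
    (hP : Orthogonal E P P) : P.IsClosedUnderExtensions where
  prop_X₂_of_shortExact {S} hS h₁ h₃ := by
    obtain ⟨s⟩ := hE.splitting hS (hP h₃ h₁ 0)
    exact P.prop_of_iso s.isoBinaryBiproduct.symm
      (P.prop_of_isLimit_binaryFan (BinaryBiproduct.isLimit _ _) h₁ h₃)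

lemma ClosedUnderDirectSummands.isStableUnderRetracts {P : ObjectProperty B}
    [P.IsClosedUnderIsomorphisms] (hP : ClosedUnderDirectSummands P) :
    P.IsStableUnderRetracts where
  of_retract {X _} r hY :=
    hP X (cokernel r.i) (P.prop_of_iso (biprod.uniqueUpToIso _ _
      (isBilimitBinaryBiconeOfIsSplitMonoOfCokernel (cokernelIsCokernel r.i))) hY)

variable (P : ObjectProperty B)

instance [P.IsClosedUnderExtensions] : P.op.IsClosedUnderExtensions where
  prop_X₂_of_shortExact hS h₁ h₃ := P.prop_X₂_of_shortExact hS.unop h₃ h₁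

instance [P.IsStableUnderRetracts] : P.op.IsStableUnderRetracts where
  of_retract r hY := P.prop_of_retract
    ⟨r.r.unop, r.i.unop, congrArg Quiver.Hom.unop r.retract⟩ hY

instance [P.ContainsZero] : P.op.ContainsZero where
  exists_zero := by
    obtain ⟨Z, hZ, hP⟩ := P.exists_prop_of_containsZero
    exact ⟨op Z, hZ.op, hP⟩

variable {P} in
lemma FiniteRes.op_op {M : B} (hM : FiniteRes P M) : FiniteRes P.op.op (op (op M)) := by
  induction hM with
  | of_mem hM => exact .of_mem hM
  | of_shortExactSeq h hX _ ih => exact .of_shortExactSeq h.op.op hX ih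

end Closure

section FiniteDimension

variable {A : Type u} [Category.{v} A] [Abelian A] [HasExt.{w} A] {W V : ObjectProperty A}
  [W.IsClosedUnderIsomorphisms] [V.IsClosedUnderIsomorphisms]

theorem finiteProjDim_of_gorenstein [W.IsClosedUnderFiniteProducts] (hWW : Perp.{w} W W)
    (hGWV : Perp.{w} (gorenstein W) V) (hWsum : ClosedUnderDirectSummands W) {M : A}
    (hM : finiteProjDim (gorenstein W) M) (hM' : finiteInjDim V M) : finiteProjDim W M := by
  have hE := isExtVanishing_extVanishes.{w} A
  have := isClosedUnderExtensions_of_orthogonal hE W hWW.orthogonal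
  have := hWsum.isStableUnderRetracts
  exact finiteProjDim_of_finiteRes <| finiteRes_of_coresolvedBy hE coresolvedBy_gorenstein
    ((orthogonal_gorenstein_left hWW.orthogonal).sup_right hGWV.orthogonal)
    (orthogonal_gorenstein_right hWW.orthogonal) (finiteRes_of_finiteProjDim hM)
    (finiteRes_of_finiteProjDim (finiteProjDim_op hM'))

theorem finiteInjDim_of_gorenstein [V.IsClosedUnderFiniteProducts] (hVV : Perp.{w} V V)
    (hWGV : Perp.{w} W (gorenstein V)) (hVsum : ClosedUnderDirectSummands V) {N : A}
    (hN : finiteInjDim (gorenstein V) N) (hN' : finiteProjDim W N) : finiteInjDim V N := by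
  have hE := isExtVanishing_extVanishes.{w} A
  have := isClosedUnderExtensions_of_orthogonal hE V hVV.orthogonal
  have := hVsum.isStableUnderRetracts
  exact finiteInjDim_of_op <| finiteProjDim_of_finiteRes <|
    finiteRes_of_coresolvedBy hE.op coresolvedBy_op_gorenstein
      ((orthogonal_gorenstein_right hVV.orthogonal).op.sup_right hWGV.orthogonal.op)
      (orthogonal_gorenstein_left hVV.orthogonal).op
      (finiteRes_of_finiteProjDim (finiteProjDim_op hN)) (finiteRes_of_finiteProjDim hN').op_op

end FiniteDimension

end RelTate

theorem theorem6p4_general {A : Type u} [Category.{v} A] [Abelian A] [HasExt.{w} A]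
    (W V : ObjectProperty A)
    [W.IsClosedUnderIsomorphisms] [W.IsClosedUnderFiniteProducts]
    [V.IsClosedUnderIsomorphisms] [V.IsClosedUnderFiniteProducts]
    (hWW : RelTate.Perp.{w} W W) (hVV : RelTate.Perp.{w} V V)
    (hGWV : RelTate.Perp.{w} (RelTate.gorenstein W) V)
    (hWGV : RelTate.Perp.{w} W (RelTate.gorenstein V))
    (hWsum : RelTate.ClosedUnderDirectSummands W)
    (hVsum : RelTate.ClosedUnderDirectSummands V) :
    (∀ M : A, RelTate.finiteProjDim (RelTate.gorenstein W) M → RelTate.finiteInjDim V M →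
      RelTate.finiteProjDim W M) ∧
    (∀ N : A, RelTate.finiteInjDim (RelTate.gorenstein V) N → RelTate.finiteProjDim W N →
      RelTate.finiteInjDim V N) :=
  ⟨fun _ => RelTate.finiteProjDim_of_gorenstein hWW hGWV hWsum,
    fun _ => RelTate.finiteInjDim_of_gorenstein hVV hWGV hVsum⟩

theorem theorem6p4 {A : Type u} [Category.{v} A] [Abelian A] [HasExt.{w} A]
    (W V : ObjectProperty A)
    [W.IsClosedUnderIsomorphisms] [W.IsClosedUnderFiniteProducts]
    [V.IsClosedUnderIsomorphisms] [V.IsClosedUnderFiniteProducts]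
    (hWW : RelTate.Perp.{w} W W) (hVV : RelTate.Perp.{w} V V)
    (hGWV : RelTate.Perp.{w} (RelTate.gorenstein W) V)
    (hWGV : RelTate.Perp.{w} W (RelTate.gorenstein V))
    (hWker : RelTate.ClosedUnderKernelsOfEpis W)
    (hWsum : RelTate.ClosedUnderDirectSummands W)
    (hVcoker : RelTate.ClosedUnderCokernelsOfMonos V)
    (hVsum : RelTate.ClosedUnderDirectSummands V)
    (hExtW : RelTate.TateExtVanishesLeft W (RelTate.finiteProjDim W) V)
    (hExtV : RelTate.TateExtVanishesRight V W (RelTate.finiteInjDim V)) :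
    (∀ M : A, RelTate.finiteProjDim (RelTate.gorenstein W) M → RelTate.finiteInjDim V M →
      RelTate.finiteProjDim W M) ∧
    (∀ N : A, RelTate.finiteInjDim (RelTate.gorenstein V) N → RelTate.finiteProjDim W N →
      RelTate.finiteInjDim V N) :=
  theorem6p4_general W V hWW hVV hGWV hWGV hWsum hVsum
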